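/- Throughout, all C*-algebras are over $\mathbb C$. For a unital C*-algebra $A$ let $\mathrm T(A)$ be its set of tracial states. For $\tau\in\mathrm T(A)$ and $a\in A$ put $\|a\|_{2,\tau}=\tau(a^*a)^{1/2}$ and $\|a\|_{2,\mathrm T(A)}=\sup_{\tau\in \mathrm T(A)}\|a\|_{2,\tau}$ (equal to $0$ if $\mathrm T(A)=\emptyset$); for $S\subseteq A$ put $\mathrm{dist}_{2,\mathrm T(A)}(a,S)=\inf_{s\in S}\|a-s\|_{2,\mathrm T(A)}$. For $a\ge 0$ put $\mathrm d_\tau(a)=\lim_{n\to\infty}\tau(a^{1/n})$. For a sub-C*-algebra $D$ let $(D)_1=\{d\in D:\|d\|\le 1\}$. Let $D\subseteq A$ be a unital commutative sub-C*-algebra. - $(D,A)$ has Property (C) if for all positive contractions $f,g,h\in D$ with $f,g\in\overline{hDh}$ and $\mathrm d_\tau(f)<\mathrm d_\tau(g)$ for all $\tau\in\mathrm T(A)$, and every $\varepsilon>0$, there is a contraction $u\in\overline{hAh}+\mathbb C1_A$ such that there is $b\in\overline{gAg}$ with $\|ufu^*-b\|_{2,\mathrm T(A)}<\varepsilon$;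 such that $\mathrm{dist}_{2,\mathrm T(A)}(udu^*,(D)_1)<\varepsilon$ and $\mathrm{dist}_{2,\mathrm T(A)}(u^*du,(D)_1)<\varepsilon$ for all $d\in(D)_1$; and such that $\|uu^*-1\|_{2,\mathrm T(A)}<\varepsilon$ and $\|u^*u-1\|_{2,\mathrm T(A)}<\varepsilon$. (Closures are in the norm of $A$.) - $(D,A)$ has Property (E) if for every positive contraction $a\in A$, every finite set $\mathcal F\subseteq \mathrm C([0,1])$ and every $\varepsilon>0$ there is a positive contraction $b\in D$ with $|\tau(f(a))-\tau(f(b))|<\varepsilon$ for all $f\in\mathcal F$ and $\tau\in\mathrm T(A)$. - $A$ has Property (S) if for every self-adjoint $f\in A$ and every $\varepsilon>0$ there are a self-adjoint $g\in A$ with $\|f-g\|_{2,\mathrm T(A)}<\varepsilon$ and a $\delta>0$ with $\tau(\chi_\delta(g))<\varepsilon$ for all $\tau\in\mathrm T(A)$, where $\chi_\delta(t)=1$ if $|t|<\delta$, $\chi_\delta(t)=2-|t|/\delta$ if $\delta\le|t|<2\delta$, and $\chi_\delta(t)=0$ otherwise. - If $D\cong\mathrm C(X)$ with $X$ compact and metrizable,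 each $\tau\in\mathrm T(A)$ restricts to $D$ and so gives a Borel probability measure $\mu_\tau$ on $X$. The pair $(D,\mathrm T(A))$ has the small boundary property if for every $x\in X$ and every open neighbourhood $U$ of $x$ there is a neighbourhood $V$ of $x$ with $V\subseteq U$ and $\mu_\tau(\partial V)=0$ for all $\tau\in\mathrm T(A)$. **Theorem 6.6.** Let $A$ be a unital simple C*-algebra and let $D=\mathrm C(X)\subseteq A$ be a unital commutative sub-C*-algebra, where $X$ is a compact metrizable space without isolated points. Assume that the pair $(D,A)$ has Properties (C) and (E). If $A$ has Property (S), then the pair $(D,\mathrm T(A))$ has the small boundary property. -/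

import Mathlib

open Filter Topology MeasureTheory

noncomputable section

namespace CStarSBP

section Traces

variable {A : Type*} [CStarAlgebra A]

/-- A unital C*-algebra is simple if it is nonzero and its only norm-closed two-sided ideals
are `0` and itself. -/
def IsSimpleCStar (A : Type*) [CStarAlgebra A] : Prop :=
  Nontrivial A ∧ ∀ I : TwoSidedIdeal A, IsClosed (I : Set A) → I = ⊥ ∨ I = ⊤

open scoped ComplexOrder in
/-- `T(A)`: the tracial states of `A`, i.e. the positive linear functionals `τ` with `τ 1 = 1` and
`τ (a b) = τ (b a)`. (Positive linear functionals on a C*-algebra are automatically bounded.) -/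
def tracialStates (A : Type*) [CStarAlgebra A] : Set (A →ₗ[ℂ] ℂ) :=
  {τ | (∀ a : A, 0 ≤ τ (star a * a)) ∧ τ 1 = 1 ∧ ∀ a b : A, τ (a * b) = τ (b * a)}

/-- `‖a‖_{2,τ} = τ(a* a)^{1/2}`. -/
def traceNorm (τ : A →ₗ[ℂ] ℂ) (a : A) : ℝ := Real.sqrt (τ (star a * a)).re

/-- The uniform trace norm `‖a‖_{2,Δ} = sup {‖a‖_{2,τ} : τ ∈ Δ}`; for `Δ ⊆ T(A)` the supremum is
over a set bounded by `‖a‖` (and it is `0` when `Δ` is empty). -/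
def uniformTraceNorm (Δ : Set (A →ₗ[ℂ] ℂ)) (a : A) : ℝ := ⨆ τ : Δ, traceNorm τ.1 a

/-- `dist_{2,T(A)}(a, S) = inf {‖a - s‖_{2,T(A)} : s ∈ S}`. -/
def uniformTraceDist (a : A) (S : Set A) : ℝ :=
  ⨅ s : S, uniformTraceNorm (tracialStates A) (a - s.1)

/-- The norm closure of `h S h = {h x h : x ∈ S}`. -/
def herClosure (h : A) (S : Set A) : Set A := closure ((fun x => h * x * h) '' S)

/-- `(D)_1`: the contractions of `D`. -/
def contractions (D : StarSubalgebra ℂ A) : Set A := {d | d ∈ D ∧ ‖d‖ ≤ 1}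

end Traces

section Order

variable {A : Type*} [CStarAlgebra A] [PartialOrder A] [StarOrderedRing A]

/-- The rank function `d_τ(a) = lim_n τ(a^{1/n})` of a positive element `a`; the sequence converges
for every `τ ∈ T(A)` and every `a ≥ 0`. -/
def rankFunction (τ : A →ₗ[ℂ] ℂ) (a : A) : ℝ :=
  limUnder atTop (fun n : ℕ => (τ (a ^ ((1 : ℝ) / (n : ℝ)))).re)

/-- Relative comparison of `D` inside `A` by almost normalizers, in the uniform trace norm. -/
def PropertyC (D : StarSubalgebra ℂ A) : Prop :=
  ∀ f g h : A, f ∈ D → g ∈ D → h ∈ D →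
    0 ≤ f → ‖f‖ ≤ 1 → 0 ≤ g → ‖g‖ ≤ 1 → 0 ≤ h → ‖h‖ ≤ 1 →
    f ∈ herClosure h (D : Set A) → g ∈ herClosure h (D : Set A) →
    (∀ τ ∈ tracialStates A, rankFunction τ f < rankFunction τ g) →
    ∀ ε : ℝ, 0 < ε →
      ∃ u : A, ‖u‖ ≤ 1 ∧
        (∃ b ∈ herClosure h (Set.univ : Set A), ∃ c : ℂ, u = b + c • (1 : A)) ∧
        (∃ b ∈ herClosure g (Set.univ : Set A),
          uniformTraceNorm (tracialStates A) (u * f * star u - b) < ε) ∧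
        (∀ d ∈ contractions D,
          uniformTraceDist (u * d * star u) (contractions D) < ε ∧
          uniformTraceDist (star u * d * u) (contractions D) < ε) ∧
        uniformTraceNorm (tracialStates A) (u * star u - 1) < ε ∧
        uniformTraceNorm (tracialStates A) (star u * u - 1) < ε

/-- The element `f(a)` for `f ∈ C([0,1])` and a positive contraction `a`. The function is extended
from `[0,1]` to `ℂ` continuously; the spectrum of `a` lies in `[0,1]`, where the extension is `f`. -/
def applyUnit (f : C(unitInterval, ℂ)) (a : A) : A :=
  cfc (fun z : ℂ => Set.IccExtend (zero_le_one' ℝ) f z.re) a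

/-- Approximation of the trace spectral distributions of the positive contractions of `A` by those
of positive contractions of `D`. -/
def PropertyE (D : StarSubalgebra ℂ A) : Prop :=
  ∀ a : A, 0 ≤ a → ‖a‖ ≤ 1 →
    ∀ (F : Finset C(unitInterval, ℂ)) (ε : ℝ), 0 < ε →
      ∃ b ∈ D, 0 ≤ b ∧ ‖b‖ ≤ 1 ∧
        ∀ f ∈ F, ∀ τ ∈ tracialStates A, ‖τ (applyUnit f a) - τ (applyUnit f b)‖ < ε

end Order

/-- The cut-off function `χ_δ`. -/
def chi (δ t : ℝ) : ℝ :=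
  if |t| < δ then 1 else if |t| < 2 * δ then 2 - |t| / δ else 0

/-- Every self-adjoint element of `A` is approximated in the uniform trace norm by self-adjoint
elements with a neighbourhood of `0` uniformly small under all tracial spectral measures. -/
def PropertyS (A : Type*) [CStarAlgebra A] : Prop :=
  ∀ f : A, IsSelfAdjoint f → ∀ ε : ℝ, 0 < ε →
    ∃ g : A, IsSelfAdjoint g ∧
      uniformTraceNorm (tracialStates A) (f - g) < ε ∧
      ∃ δ : ℝ, 0 < δ ∧ ∀ τ ∈ tracialStates A, (τ (cfc (chi δ) g)).re < ε

section SBP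

variable {X : Type*} [TopologicalSpace X] [MeasurableSpace X]

/-- The small boundary property of a compact metrizable space `X` with respect to a collection `Δ`
of Borel probability measures. -/
def SmallBoundaryProperty (Δ : Set (Measure X)) : Prop :=
  ∀ (x : X) (U : Set X), IsOpen U → x ∈ U →
    ∃ V ∈ 𝓝 x, V ⊆ U ∧ ∀ μ ∈ Δ, μ (frontier V) = 0

/-- The Borel probability measures on `X` that correspond (by the Riesz representation theorem) to
the restrictions to `D ≅ C(X)` of the tracial states of `A`. -/
def traceMeasures {A : Type*} [CStarAlgebra A] {D : StarSubalgebra ℂ A}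
    (e : C(X, ℂ) ≃⋆ₐ[ℂ] D) : Set (Measure X) :=
  {μ | IsProbabilityMeasure μ ∧
    ∃ τ ∈ tracialStates A, ∀ f : C(X, ℂ), τ ((e f : D) : A) = ∫ x, f x ∂μ}

end SBP

end CStarSBP

end

noncomputable section

namespace CStarSBP

/-! ### Trace norms and simplicity. -/

section TraceCalculus

variable {A : Type*} [CStarAlgebra A] {τ : A →ₗ[ℂ] ℂ}

/-! If the zero set of a continuous `f` is null for every `μ_τ`, then `{f < 0}` has null boundary.
By Baire category in `C(X, ℝ)` it suffices that every `F` is a uniform limit of functions `f` for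
which some `{|f| < δ}` has uniformly small measure (`smallBoundaryProperty_of_dense`).

Property (S) gives such approximants only in `A` and only in trace norm. A steep ramp, applied to an
approximant of `F - 3` inside the window where it has little mass, yields an almost projection in
`A` with traces squeezed between cut-offs of `F` (`exists_almost_projection`). Property (E) copies
its traces into `D`, but in an unknown position. Property (C) moves the copy under `{F > 0}`, and
back into `D` up to a small error (`exists_almost_indicator`). The strict rank inequality that (C)
demands comes from simplicity: a nonzero gap between two cut-offs of `F` has trace bounded below
uniformly in `τ`.

The resulting `Q` is controlled one-sidedly in position and otherwise only in total mass. Averaging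
repairs this (`exists_small_near_zero`): such functions are stacked over many unit levels of a large
multiple `c F`. Their sum differs from the shifted `c F`, near its zeros, by an amount bounded in
mean independently of `c`, whereas the allowed uniform error `C = c η` is large. Truncating the sum
to within `C` of `c F` therefore matters only on a small set. Elsewhere a zero of the approximant
puts the sum near a half-integer, so the summands are not all close to `0` or `1`, which again
happens only on a small set. -/

lemma traceNorm_nonneg (a : A) : 0 ≤ traceNorm τ a := Real.sqrt_nonneg _

lemma traceNorm_zero : traceNorm τ (0 : A) = 0 := by simp [traceNorm]

lemma traceNorm_neg (a : A) : traceNorm τ (-a) = traceNorm τ a := by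
  simp only [traceNorm, star_neg, neg_mul_neg]

lemma traceNorm_sub_comm (a b : A) : traceNorm τ (a - b) = traceNorm τ (b - a) := by
  rw [← neg_sub b a, traceNorm_neg]

lemma traceNorm_one (hτ : τ ∈ tracialStates A) : traceNorm τ (1 : A) = 1 := by
  simp [traceNorm, hτ.2.1]

lemma trace_mul_comm (hτ : τ ∈ tracialStates A) (a b : A) : τ (a * b) = τ (b * a) := hτ.2.2 a b

lemma traceNorm_star (hτ : τ ∈ tracialStates A) (a : A) :
    traceNorm τ (star a) = traceNorm τ a := by
  rw [traceNorm, traceNorm, star_star, trace_mul_comm hτ]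

variable [PartialOrder A] [StarOrderedRing A]

open scoped ComplexOrder in
/-- A tracial state as a positive linear map. -/
def tracePos (hτ : τ ∈ tracialStates A) : A →ₚ[ℂ] ℂ :=
  PositiveLinearMap.mk₀ τ fun a ha => by
    obtain ⟨s, rfl⟩ := CStarAlgebra.nonneg_iff_eq_star_mul_self.mp ha
    exact hτ.1 s

/-- Identifying the trace norm with the GNS seminorm makes the triangle and Cauchy–Schwarz
inequalities available. -/
lemma traceNorm_eq_norm (hτ : τ ∈ tracialStates A) (a : A) :
    traceNorm τ a = ‖(tracePos hτ).toPreGNS a‖ := rfl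

lemma traceNorm_add_le (hτ : τ ∈ tracialStates A) (a b : A) :
    traceNorm τ (a + b) ≤ traceNorm τ a + traceNorm τ b := by
  simp only [traceNorm_eq_norm hτ, map_add]
  exact norm_add_le _ _

/-- Triangle inequality through an intermediate point. -/
lemma traceNorm_sub_le (hτ : τ ∈ tracialStates A) (a b c : A) :
    traceNorm τ (a - c) ≤ traceNorm τ (a - b) + traceNorm τ (b - c) := by
  have := traceNorm_add_le hτ (a - b) (b - c)
  simpa using this

lemma norm_trace_star_mul_le (hτ : τ ∈ tracialStates A) (a b : A) :
    ‖τ (star a * b)‖ ≤ traceNorm τ a * traceNorm τ b := by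
  have := norm_inner_le_norm (𝕜 := ℂ) ((tracePos hτ).toPreGNS a) ((tracePos hτ).toPreGNS b)
  rwa [PositiveLinearMap.preGNS_inner_def] at this

lemma trace_re_nonneg (hτ : τ ∈ tracialStates A) {a : A} (ha : 0 ≤ a) : 0 ≤ (τ a).re := by
  obtain ⟨s, rfl⟩ := CStarAlgebra.nonneg_iff_eq_star_mul_self.mp ha
  exact (Complex.le_def.mp (hτ.1 s)).1

lemma trace_re_mono (hτ : τ ∈ tracialStates A) {a b : A} (h : a ≤ b) : (τ a).re ≤ (τ b).re := by
  have := trace_re_nonneg hτ (sub_nonneg.mpr h)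
  simpa using this

lemma traceNorm_sq (hτ : τ ∈ tracialStates A) (a : A) :
    traceNorm τ a ^ 2 = (τ (star a * a)).re :=
  Real.sq_sqrt (trace_re_nonneg hτ (star_mul_self_nonneg a))

/-- Apply `τ` to `a* (x* x) a ≤ ‖x‖² a* a`. -/
lemma traceNorm_mul_le (hτ : τ ∈ tracialStates A) (x a : A) :
    traceNorm τ (x * a) ≤ ‖x‖ * traceNorm τ a := by
  refine abs_le_of_sq_le_sq' ?_ (mul_nonneg (norm_nonneg _) (traceNorm_nonneg _)) |>.2
  rw [mul_pow, traceNorm_sq hτ, traceNorm_sq hτ]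
  have h := CStarAlgebra.star_left_conjugate_le_norm_smul (a := a) (b := star x * x)
  have h2 := trace_re_mono hτ h
  rw [CStarRing.norm_star_mul_self] at h2
  have e : star (x * a) * (x * a) = star a * (star x * x) * a := by simp [mul_assoc]
  rw [e]
  refine h2.trans_eq ?_
  rw [← Complex.coe_smul]
  simp [sq]

lemma traceNorm_mul_le' (hτ : τ ∈ tracialStates A) (x a : A) :
    traceNorm τ (a * x) ≤ traceNorm τ a * ‖x‖ := by
  rw [← traceNorm_star hτ, star_mul, mul_comm, ← traceNorm_star hτ a, ← norm_star x]
  exact traceNorm_mul_le hτ _ _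

lemma traceNorm_le_norm (hτ : τ ∈ tracialStates A) (a : A) : traceNorm τ a ≤ ‖a‖ := by
  simpa [traceNorm_one hτ] using traceNorm_mul_le hτ a 1

lemma norm_trace_le (hτ : τ ∈ tracialStates A) (a : A) : ‖τ a‖ ≤ traceNorm τ a := by
  simpa [traceNorm_one hτ] using norm_trace_star_mul_le hτ 1 a

lemma trace_re_le_add (hτ : τ ∈ tracialStates A) (a b : A) :
    (τ a).re ≤ (τ b).re + traceNorm τ (a - b) := by
  have h1 := (Complex.re_le_norm _).trans (norm_trace_le hτ (a - b))
  simp only [map_sub, Complex.sub_re] at h1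
  linarith

lemma trace_mul_re_nonneg (hτ : τ ∈ tracialStates A) {a b : A} (ha : 0 ≤ a) (hb : 0 ≤ b) :
    0 ≤ (τ (a * b)).re := by
  obtain ⟨s, rfl⟩ := CStarAlgebra.nonneg_iff_eq_star_mul_self.mp ha
  rw [mul_assoc, trace_mul_comm hτ]
  apply trace_re_nonneg hτ
  have := star_right_conjugate_nonneg hb s
  simpa [mul_assoc] using this

lemma traceNorm_star_mul_self_sub_le (hτ : τ ∈ tracialStates A) {a b : A} (ha : ‖a‖ ≤ 1)
    (hb : ‖b‖ ≤ 1) : traceNorm τ (star a * a - star b * b) ≤ 2 * traceNorm τ (a - b) := by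
  have e : star a * a - star b * b = star a * (a - b) + star (a - b) * b := by
    rw [star_sub]; noncomm_ring
  rw [e]
  have h1 := traceNorm_mul_le hτ (star a) (a - b)
  have h2 := traceNorm_mul_le' hτ b (star (a - b))
  rw [norm_star] at h1
  rw [traceNorm_star hτ] at h2
  have h3 := traceNorm_add_le hτ (star a * (a - b)) (star (a - b) * b)
  nlinarith [traceNorm_nonneg (τ := τ) (a - b)]

lemma traceNorm_le_uniform {Δ : Set (A →ₗ[ℂ] ℂ)} (hΔ : Δ ⊆ tracialStates A) (hτ : τ ∈ Δ) (a : A) :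
    traceNorm τ a ≤ uniformTraceNorm Δ a :=
  le_ciSup (f := fun σ : Δ => traceNorm σ.1 a)
    ⟨‖a‖, by rintro _ ⟨σ, rfl⟩; exact traceNorm_le_norm (hΔ σ.2) a⟩ ⟨τ, hτ⟩

lemma traceNorm_lt_of_uniform (hτ : τ ∈ tracialStates A) {a : A} {ε : ℝ}
    (h : uniformTraceNorm (tracialStates A) a < ε) : traceNorm τ a < ε :=
  (traceNorm_le_uniform subset_rfl hτ a).trans_lt h

/-- A spectral separation estimate: if `φ` lives where `f ≥ l` and `ψ` lives where `g ≤ m`, then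
`φ ψ` is controlled by `f - g` in trace norm. -/
lemma traceNorm_mul_le_of_separated (hτ : τ ∈ tracialStates A) {f g φ ψ : A} {l m : ℝ}
    (hφ : IsSelfAdjoint φ) (hψ : IsSelfAdjoint ψ) (hφn : ‖φ‖ ≤ 1) (hψn : ‖ψ‖ ≤ 1)
    (hf : f * φ = φ * f) (hg : g * ψ = ψ * g)
    (hl : l • (φ * φ) ≤ φ * f * φ) (hm : ψ * g * ψ ≤ m • (ψ * ψ)) :
    (l - m) * traceNorm τ (φ * ψ) ≤ traceNorm τ (f - g) := by
  set x := φ * ψ with hx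
  have hsx : star x = ψ * φ := by rw [hx, star_mul, hφ.star_eq, hψ.star_eq]
  -- Pairing `f x - x g` with `x` under `τ` gives at least `(l - m) ‖x‖²`, traciality serving for
  -- the `g` term; Cauchy–Schwarz bounds the pairing by `‖x‖ ‖f - g‖`.
  have hy : φ * (f - g) * ψ = f * x - x * g := by
    rw [hx, mul_sub, sub_mul, ← hf, mul_assoc φ g ψ, hg]; simp only [mul_assoc]
  have h1 : l * traceNorm τ x ^ 2 ≤ (τ (star x * (f * x))).re := by
    have h := star_left_conjugate_le_conjugate hl ψ
    rw [hψ.star_eq] at h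
    have h := trace_re_mono hτ h
    rw [traceNorm_sq hτ, hsx, hx]
    have e1 : ψ * (l • (φ * φ)) * ψ = (l : ℂ) • (ψ * φ * (φ * ψ)) := by
      rw [Complex.coe_smul, mul_smul_comm, smul_mul_assoc]; simp only [mul_assoc]
    have e2 : ψ * (φ * f * φ) * ψ = ψ * φ * (f * (φ * ψ)) := by simp only [mul_assoc]
    rw [e1, e2] at h
    simpa using h
  have h2 : (τ (star x * (x * g))).re ≤ m * traceNorm τ x ^ 2 := by
    have h := star_left_conjugate_le_conjugate hm φ
    rw [hφ.star_eq] at h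
    have h := trace_re_mono hτ h
    rw [← traceNorm_star hτ, traceNorm_sq hτ, star_star, hsx, hx]
    have e1 : φ * (m • (ψ * ψ)) * φ = (m : ℂ) • (φ * ψ * (ψ * φ)) := by
      rw [Complex.coe_smul, mul_smul_comm, smul_mul_assoc]; simp only [mul_assoc]
    have e2 : τ (φ * (ψ * g * ψ) * φ) = τ (ψ * φ * (φ * ψ * g)) := by
      rw [mul_assoc φ ψ g, ← hg, trace_mul_comm hτ (ψ * φ)]; simp only [mul_assoc]
    rw [e1, e2] at h
    simpa using h
  have h3 : (τ (star x * (f * x - x * g))).re ≤ traceNorm τ x * traceNorm τ (f - g) := by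
    refine (Complex.re_le_norm _).trans ((norm_trace_star_mul_le hτ _ _).trans ?_)
    gcongr
    · exact traceNorm_nonneg _
    rw [← hy]
    calc _ ≤ traceNorm τ (φ * (f - g)) * ‖ψ‖ := traceNorm_mul_le' hτ _ _
      _ ≤ traceNorm τ (φ * (f - g)) * 1 := by gcongr; exact traceNorm_nonneg _
      _ ≤ ‖φ‖ * traceNorm τ (f - g) := by rw [mul_one]; exact traceNorm_mul_le hτ _ _
      _ ≤ 1 * traceNorm τ (f - g) := by gcongr; exact traceNorm_nonneg _
      _ = _ := one_mul _
  rw [mul_sub, map_sub, Complex.sub_re] at h3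
  rcases (traceNorm_nonneg (τ := τ) x).eq_or_lt with h0 | h0
  · rw [← h0, mul_zero]; exact traceNorm_nonneg _
  · refine le_of_mul_le_mul_left ?_ h0
    nlinarith

/-- In a simple algebra, a nonzero element is bounded below in trace norm, uniformly over the
tracial states. -/
lemma exists_pos_le_traceNorm (hA : IsSimpleCStar A) {k : A} (hk : k ≠ 0) :
    ∃ κ : ℝ, 0 < κ ∧ ∀ τ ∈ tracialStates A, κ ≤ traceNorm τ k := by
  -- These elements form a two-sided ideal containing `k`; the slack `ε` makes it norm closed. By
  -- simplicity it contains `1`, whose trace norm is `1` for every `τ`.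
  let S : Set A := {a | ∀ ε : ℝ, 0 < ε → ∃ C : ℝ, ∀ τ ∈ tracialStates A,
    traceNorm τ a ≤ C * traceNorm τ k + ε}
  have hmul : ∀ (x : A) {ε : ℝ}, 0 < ε → ∃ ε', 0 < ε' ∧ ‖x‖ * ε' ≤ ε := fun x ε hε =>
    ⟨ε / (‖x‖ + 1), by positivity, by
      rw [mul_div_assoc', div_le_iff₀ (by positivity)]; nlinarith [norm_nonneg x]⟩
  let I : TwoSidedIdeal A := TwoSidedIdeal.mk' S
    (fun ε hε => ⟨0, fun τ _ => by simpa [traceNorm_zero] using hε.le⟩)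
    (fun {a b} ha hb ε hε => by
      obtain ⟨C, hC⟩ := ha (ε / 2) (by positivity)
      obtain ⟨C', hC'⟩ := hb (ε / 2) (by positivity)
      refine ⟨C + C', fun τ hτ => ?_⟩
      have := traceNorm_add_le hτ a b
      have := hC τ hτ
      have := hC' τ hτ
      linarith)
    (fun {a} ha ε hε => by
      obtain ⟨C, hC⟩ := ha ε hε
      refine ⟨C, fun τ hτ => ?_⟩
      rw [traceNorm_neg]
      exact hC τ hτ)
    (fun {x a} ha ε hε => by
      obtain ⟨ε', hε', h⟩ := hmul x hε
      obtain ⟨C, hC⟩ := ha ε' hε'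
      refine ⟨‖x‖ * C, fun τ hτ => (traceNorm_mul_le hτ x a).trans ?_⟩
      have := mul_le_mul_of_nonneg_left (hC τ hτ) (norm_nonneg x)
      linarith)
    (fun {a x} ha ε hε => by
      obtain ⟨ε', hε', h⟩ := hmul x hε
      obtain ⟨C, hC⟩ := ha ε' hε'
      refine ⟨‖x‖ * C, fun τ hτ => (traceNorm_mul_le' hτ x a).trans ?_⟩
      have := mul_le_mul_of_nonneg_left (hC τ hτ) (norm_nonneg x)
      linarith)
  have hI : (I : Set A) = S := TwoSidedIdeal.coe_mk' _ _ _ _ _ _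
  have hcl : IsClosed (I : Set A) := by
    rw [hI, ← closure_subset_iff_isClosed]
    intro a ha ε hε
    obtain ⟨b, hb, hab⟩ := Metric.mem_closure_iff.mp ha (ε / 2) (by positivity)
    obtain ⟨C, hC⟩ := hb (ε / 2) (by positivity)
    refine ⟨C, fun τ hτ => ?_⟩
    have h1 := traceNorm_add_le hτ (a - b) b
    have h2 := traceNorm_le_norm hτ (a - b)
    rw [dist_eq_norm] at hab
    have := hC τ hτ
    rw [sub_add_cancel] at h1
    linarith
  have hkI : k ∈ S := fun ε hε => ⟨1, fun τ _ => by linarith⟩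
  have h1 : (1 : A) ∈ S := by
    rcases hA.2 I hcl with h | h
    · exact absurd (by rw [← hI, h] at hkI; simpa using hkI) hk
    · rw [← hI, h]; trivial
  obtain ⟨C, hC⟩ := h1 (1 / 2) (by norm_num)
  refine ⟨1 / (2 * (|C| + 1)), by positivity, fun τ hτ => ?_⟩
  have h := hC τ hτ
  rw [traceNorm_one hτ] at h
  rw [div_le_iff₀ (by positivity)]
  nlinarith [le_abs_self C, traceNorm_nonneg (τ := τ) k]

end TraceCalculus

/-- The truncation of a real number to `[0,1]`. -/
def clampUnit (t : ℝ) : ℝ := max 0 (min 1 t)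

lemma continuous_clampUnit : Continuous clampUnit := by unfold clampUnit; fun_prop

lemma clampUnit_nonneg (t : ℝ) : 0 ≤ clampUnit t := le_max_left _ _

lemma clampUnit_le_one (t : ℝ) : clampUnit t ≤ 1 := by simp [clampUnit]

lemma clampUnit_of_nonpos {t : ℝ} (h : t ≤ 0) : clampUnit t = 0 := by
  simp [clampUnit, h]

lemma clampUnit_of_one_le {t : ℝ} (h : 1 ≤ t) : clampUnit t = 1 := by
  simp [clampUnit, h]

lemma clampUnit_of_mem {t : ℝ} (h0 : 0 ≤ t) (h1 : t ≤ 1) : clampUnit t = t := by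
  simp [clampUnit, h0, h1]

lemma monotone_clampUnit : Monotone clampUnit := fun s t h => by
  unfold clampUnit; gcongr

/-! ### Real functions on `X` as elements of `A`, and their ranks. -/

section Embedding

variable {X : Type*} [TopologicalSpace X]

/-- Pointwise truncation of a continuous function to `[0,1]`. -/
def clamp (F : C(X, ℝ)) : C(X, ℝ) :=
  ⟨fun x => clampUnit (F x), continuous_clampUnit.comp F.continuous⟩

@[simp] lemma clamp_apply (F : C(X, ℝ)) (x : X) : clamp F x = clampUnit (F x) := rfl

variable {A : Type*} [CStarAlgebra A] {D : StarSubalgebra ℂ A}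
  (e : C(X, ℂ) ≃⋆ₐ[ℂ] D)

/-- The real functions inside `D ≅ C(X)`, as elements of `A`. -/
def realEmb : C(X, ℝ) →ₐ[ℝ] A :=
  AlgHom.ofLinearMap
    { toFun := fun F => ((e ⟨fun x => (F x : ℂ), by fun_prop⟩ : D) : A)
      map_add' := fun F G => by
        change ((e _ : D) : A) = ((e _ + e _ : D) : A)
        rw [← map_add e]; congr 2; ext x; simp
      map_smul' := fun r F => by
        rw [RingHom.id_apply, ← Complex.coe_smul]
        change ((e _ : D) : A) = (((r : ℂ) • e _ : D) : A)
        rw [← map_smul e]; congr 2; ext x; simp }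
    (by
      change ((e _ : D) : A) = ((1 : D) : A)
      rw [← map_one e]; congr 2)
    (fun F G => by
      change ((e _ : D) : A) = ((e _ * e _ : D) : A)
      rw [← map_mul e]; congr 2; ext x; simp)

lemma realEmb_apply (F : C(X, ℝ)) :
    realEmb e F = ((e ⟨fun x => (F x : ℂ), by fun_prop⟩ : D) : A) := rfl

lemma realEmb_mem (F : C(X, ℝ)) : realEmb e F ∈ D := Subtype.property _

lemma realEmb_injective : Function.Injective (realEmb e) := fun F G h => by
  have := EquivLike.injective e (Subtype.ext h)
  ext x
  have hx := congrArg (fun f : C(X, ℂ) => f x) this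
  simpa using hx

lemma isSelfAdjoint_realEmb (F : C(X, ℝ)) : IsSelfAdjoint (realEmb e F) := by
  change star ((e _ : D) : A) = ((e _ : D) : A)
  rw [← StarMemClass.coe_star, ← map_star]
  congr 2; ext x; simp

lemma realEmb_mul_comm (F G : C(X, ℝ)) : realEmb e F * realEmb e G = realEmb e G * realEmb e F := by
  rw [← map_mul, mul_comm, map_mul]

variable [PartialOrder A] [StarOrderedRing A]

lemma realEmb_nonneg {F : C(X, ℝ)} (hF : 0 ≤ F) : 0 ≤ realEmb e F := by
  have h : F = ⟨fun x => √(F x), by fun_prop⟩ * ⟨fun x => √(F x), by fun_prop⟩ := by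
    ext x; exact (Real.mul_self_sqrt (hF x)).symm
  rw [h, map_mul]
  exact (isSelfAdjoint_realEmb e _).mul_self_nonneg

lemma realEmb_mono {F G : C(X, ℝ)} (h : F ≤ G) : realEmb e F ≤ realEmb e G := by
  have := realEmb_nonneg e (sub_nonneg.mpr h)
  rwa [map_sub, sub_nonneg] at this

lemma norm_realEmb_le_one {F : C(X, ℝ)} (h0 : 0 ≤ F) (h1 : F ≤ 1) : ‖realEmb e F‖ ≤ 1 := by
  rw [CStarAlgebra.norm_le_one_iff_of_nonneg _ (realEmb_nonneg e h0)]
  simpa using realEmb_mono e h1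

/-- Conjugating by the negative part `G` of `F` turns `F` into `-G³`, which must then be both
positive and negative, so `G³ = 0` by injectivity. -/
lemma nonneg_of_realEmb_nonneg {F : C(X, ℝ)} (h : 0 ≤ realEmb e F) : 0 ≤ F := by
  let G : C(X, ℝ) := ⟨fun x => max (-F x) 0, by fun_prop⟩
  have hG : 0 ≤ G := fun x => le_max_right _ _
  have h1 : G * F * G = -(G * G * G) := by
    ext x
    change max (-F x) 0 * F x * max (-F x) 0 = -(max (-F x) 0 * max (-F x) 0 * max (-F x) 0)
    rcases le_total (-F x) 0 with hx | hx
    · simp [max_eq_right hx]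
    · rw [max_eq_left hx]; ring
  have h2 := (isSelfAdjoint_realEmb e G).conjugate_nonneg h
  rw [← map_mul, ← map_mul, h1, map_neg] at h2
  have h3 := realEmb_nonneg e (mul_nonneg (mul_nonneg hG hG) hG)
  have h4 : realEmb e (G * G * G) = realEmb e 0 := by
    rw [map_zero]; exact le_antisymm (neg_nonneg.mp h2) h3
  have h5 := realEmb_injective e h4
  intro x
  have h6 : max (-F x) 0 * max (-F x) 0 * max (-F x) 0 = 0 := congrArg (fun f : C(X, ℝ) => f x) h5
  have h7 : max (-F x) 0 = 0 := by simpa using h6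
  have := le_max_left (-F x) 0
  change 0 ≤ F x
  linarith

lemma exists_realEmb_eq {b : A} (hb : b ∈ D) (h0 : 0 ≤ b) (h1 : ‖b‖ ≤ 1) :
    ∃ B : C(X, ℝ), 0 ≤ B ∧ B ≤ 1 ∧ realEmb e B = b := by
  obtain ⟨f, hf⟩ : ∃ f, e f = ⟨b, hb⟩ := EquivLike.surjective e _
  have hs : star f = f := by
    apply EquivLike.injective e
    rw [map_star, hf]
    exact Subtype.ext h0.isSelfAdjoint.star_eq
  let B : C(X, ℝ) := ⟨fun x => (f x).re, by fun_prop⟩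
  have hB : realEmb e B = b := by
    rw [realEmb_apply, show b = ((e f : D) : A) by rw [hf]]
    congr 2
    ext x
    have := congrArg (fun g : C(X, ℂ) => g x) hs
    exact (Complex.conj_eq_iff_re.mp this)
  refine ⟨B, nonneg_of_realEmb_nonneg e (hB ▸ h0), ?_, hB⟩
  refine sub_nonneg.mp (nonneg_of_realEmb_nonneg e ?_)
  rw [map_sub, map_one, hB, sub_nonneg]
  exact (CStarAlgebra.norm_le_one_iff_of_nonneg _ h0).mp h1

/-- The functional on real continuous functions given by a trace. -/
def traceFun (τ : A →ₗ[ℂ] ℂ) : C(X, ℝ) →ₗ[ℝ] ℝ :=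
  Complex.reLm ∘ₗ τ.restrictScalars ℝ ∘ₗ (realEmb e).toLinearMap

omit [PartialOrder A] [StarOrderedRing A] in
lemma traceFun_apply (τ : A →ₗ[ℂ] ℂ) (F : C(X, ℝ)) : traceFun e τ F = (τ (realEmb e F)).re := rfl

variable {τ : A →ₗ[ℂ] ℂ}

lemma traceFun_mono (hτ : τ ∈ tracialStates A) {F G : C(X, ℝ)} (h : F ≤ G) :
    traceFun e τ F ≤ traceFun e τ G :=
  trace_re_mono hτ (realEmb_mono e h)

lemma traceFun_nonneg (hτ : τ ∈ tracialStates A) {F : C(X, ℝ)} (h : 0 ≤ F) :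
    0 ≤ traceFun e τ F :=
  trace_re_nonneg hτ (realEmb_nonneg e h)

omit [PartialOrder A] [StarOrderedRing A] in
lemma traceFun_one (hτ : τ ∈ tracialStates A) : traceFun e τ 1 = 1 := by
  rw [traceFun_apply, map_one, hτ.2.1, Complex.one_re]

/-- The `n`-th root of a nonnegative continuous function. -/
def rootFun (B : C(X, ℝ)) (n : ℕ) : C(X, ℝ) :=
  ⟨fun x => B x ^ ((1 : ℝ) / (n : ℝ)), B.continuous.rpow_const fun _ => Or.inr (by positivity)⟩

lemma realEmb_rpow {B : C(X, ℝ)} (hB : 0 ≤ B) {n : ℕ} (hn : n ≠ 0) :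
    realEmb e B ^ ((1 : ℝ) / (n : ℝ)) = realEmb e (rootFun B n) := by
  have h0 : 0 ≤ rootFun B n := fun x => Real.rpow_nonneg (hB x) _
  have hc := realEmb_nonneg e h0
  have hp : rootFun B n ^ n = B := by
    ext x
    change (B x ^ ((1 : ℝ) / (n : ℝ))) ^ n = B x
    rw [one_div, Real.rpow_inv_natCast_pow (show 0 ≤ B x from hB x) hn]
  conv_lhs => rw [← hp, map_pow]
  rw [← CFC.rpow_natCast _ n hc, CFC.rpow_rpow_of_exponent_nonneg _ _ _ (by positivity)
    (by positivity) hc, mul_one_div_cancel (by exact_mod_cast hn), CFC.rpow_one _ hc]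

/-- The roots of a positive contraction increase with `n`, and their traces are bounded by `1`. The
index `n + 1` avoids the exponent `1 / 0 = 0`. -/
lemma tendsto_rankFunction (hτ : τ ∈ tracialStates A) {B : C(X, ℝ)} (h0 : 0 ≤ B) (h1 : B ≤ 1) :
    Tendsto (fun n : ℕ => traceFun e τ (rootFun B (n + 1))) atTop
      (𝓝 (rankFunction τ (realEmb e B))) := by
  have hmono : Monotone fun n : ℕ => traceFun e τ (rootFun B (n + 1)) := by
    intro m n hmn
    refine traceFun_mono e hτ fun x => ?_
    rcases (show 0 ≤ B x from h0 x).eq_or_lt with hx | hx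
    · change B x ^ _ ≤ B x ^ _
      rw [← hx]
      rw [Real.zero_rpow (by positivity), Real.zero_rpow (by positivity)]
    · refine Real.rpow_le_rpow_of_exponent_ge hx (h1 x) ?_
      gcongr
  have hbdd : BddAbove (Set.range fun n : ℕ => traceFun e τ (rootFun B (n + 1))) := by
    refine ⟨traceFun e τ 1, ?_⟩
    rintro _ ⟨n, rfl⟩
    exact traceFun_mono e hτ fun x => Real.rpow_le_one (h0 x) (h1 x) (by positivity)
  have ht := tendsto_atTop_ciSup hmono hbdd
  have hlim : Tendsto (fun n : ℕ => (τ (realEmb e B ^ ((1 : ℝ) / (n : ℝ)))).re) atTop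
      (𝓝 (⨆ n : ℕ, traceFun e τ (rootFun B (n + 1)))) := by
    rw [← tendsto_add_atTop_iff_nat 1]
    refine ht.congr fun n => ?_
    rw [realEmb_rpow e h0 n.succ_ne_zero, traceFun_apply]
  rw [rankFunction, hlim.limUnder_eq]
  exact ht

lemma rankFunction_le (hτ : τ ∈ tracialStates A) {B K : C(X, ℝ)} (h0 : 0 ≤ B) (h1 : B ≤ 1)
    (hK : 0 ≤ K) (hBK : ∀ x, 0 < B x → 1 ≤ K x) :
    rankFunction τ (realEmb e B) ≤ traceFun e τ K := by
  refine le_of_tendsto' (tendsto_rankFunction e hτ h0 h1) fun n => traceFun_mono e hτ fun x => ?_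
  change B x ^ _ ≤ K x
  rcases (show 0 ≤ B x from h0 x).eq_or_lt with hx | hx
  · rw [← hx]
    rw [Real.zero_rpow (by positivity)]
    exact hK x
  · exact (Real.rpow_le_one (h0 x) (h1 x) (by positivity)).trans (hBK x hx)

lemma le_rankFunction (hτ : τ ∈ tracialStates A) {B : C(X, ℝ)} (h0 : 0 ≤ B) (h1 : B ≤ 1) :
    traceFun e τ B ≤ rankFunction τ (realEmb e B) := by
  refine ge_of_tendsto' (tendsto_rankFunction e hτ h0 h1) fun n => traceFun_mono e hτ fun x => ?_
  change B x ≤ B x ^ _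
  refine Real.self_le_rpow_of_le_one (h0 x) (h1 x) ?_
  rw [div_le_one (by positivity)]
  push_cast
  linarith [(n.cast_nonneg : (0 : ℝ) ≤ n)]

end Embedding

/-! ### From Properties (S), (E) and (C) to almost indicators in `D`. -/

section Core

variable {X : Type*} [TopologicalSpace X] {A : Type*} [CStarAlgebra A] [PartialOrder A]
  [StarOrderedRing A] {D : StarSubalgebra ℂ A} (e : C(X, ℂ) ≃⋆ₐ[ℂ] D)

lemma clamp_nonneg (F : C(X, ℝ)) : 0 ≤ clamp F := fun x => clampUnit_nonneg (F x)

lemma clamp_le_one (F : C(X, ℝ)) : clamp F ≤ 1 := fun x => clampUnit_le_one (F x)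

lemma chi_eq_clampUnit {δ : ℝ} (hδ : 0 < δ) : chi δ = fun t => clampUnit (2 - |t| / δ) := by
  ext t
  unfold chi
  split_ifs with h1 h2
  · rw [clampUnit_of_one_le]
    have := (div_lt_one hδ).mpr h1
    linarith
  · rw [clampUnit_of_mem]
    · have := (div_lt_iff₀ hδ).mpr h2
      linarith
    · have := (one_le_div hδ).mpr (not_lt.mp h1)
      linarith
  · rw [clampUnit_of_nonpos]
    have := (le_div_iff₀ hδ).mpr (not_lt.mp h2)
    linarith

/-- The functional calculus of a self-adjoint element at a ramp function `r` that passes from `0`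
to `1` on `[-d, d]`. -/
lemma cfc_ramp {g : A} (hg : IsSelfAdjoint g) {r : ℝ → ℝ} {d δ : ℝ} (hr : Continuous r)
    (hr0 : ∀ t, 0 ≤ r t) (hr1 : ∀ t, r t ≤ 1) (hrlow : ∀ t, t ≤ -d → r t = 0)
    (hrhigh : ∀ t, d ≤ t → r t = 1) (hδ : 0 < δ) (hdδ : d ≤ δ) :
    0 ≤ cfc r g ∧ cfc r g ≤ 1 ∧ g * cfc r g = cfc r g * g ∧
      (-d) • (cfc r g * cfc r g) ≤ cfc r g * g * cfc r g ∧
      (1 - cfc r g) * g * (1 - cfc r g) ≤ d • ((1 - cfc r g) * (1 - cfc r g)) ∧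
      cfc r g - cfc r g * cfc r g ≤ cfc (chi δ) g := by
  set p := cfc r g with hp
  have hp0 : 0 ≤ p := cfc_nonneg fun t _ => hr0 t
  have hp1 : p ≤ 1 := cfc_le_one r g fun t _ => hr1 t
  have hq : 1 - p = cfc (fun t => 1 - r t) g := by
    rw [cfc_sub (fun _ => 1) r g, cfc_const_one ℝ g]
  have hgp : g * p = p * g := ((Commute.refl g).cfc_real r).eq.symm
  have hlow : (-d) • (p * p) ≤ p * g * p := by
    have e1 : p * p = cfc (fun t => r t * r t) g := (cfc_mul r r g).symm
    have e2 : p * g * p = cfc (fun t => r t * t * r t) g := by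
      rw [cfc_mul (fun t => r t * t) r g, cfc_mul r (fun t => t) g, cfc_id' ℝ g]
    rw [e1, e2, ← cfc_smul (-d) (fun t => r t * r t) g]
    refine cfc_mono fun t _ => ?_
    rcases le_total t (-d) with ht | ht
    · simp [hrlow t ht]
    · rw [smul_eq_mul]
      nlinarith [mul_self_nonneg (r t)]
  have hhigh : (1 - p) * g * (1 - p) ≤ d • ((1 - p) * (1 - p)) := by
    have e1 : (1 - p) * (1 - p) = cfc (fun t => (1 - r t) * (1 - r t)) g := by
      rw [hq, ← cfc_mul (fun t => 1 - r t) (fun t => 1 - r t) g]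
    have e2 : (1 - p) * g * (1 - p) = cfc (fun t => (1 - r t) * t * (1 - r t)) g := by
      rw [cfc_mul (fun t => (1 - r t) * t) (fun t => 1 - r t) g,
        cfc_mul (fun t => 1 - r t) (fun t => t) g, cfc_id' ℝ g, hq]
    rw [e1, e2, ← cfc_smul d (fun t => (1 - r t) * (1 - r t)) g]
    refine cfc_mono fun t _ => ?_
    rcases le_total d t with ht | ht
    · simp [hrhigh t ht]
    · rw [smul_eq_mul]
      nlinarith [mul_self_nonneg (1 - r t)]
  have hpp : p - p * p ≤ cfc (chi δ) g := by
    have e1 : p - p * p = cfc (fun t => r t - r t * r t) g := by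
      rw [cfc_sub r (fun t => r t * r t) g, cfc_mul r r g]
    have hcc : Continuous (chi δ) := by
      rw [chi_eq_clampUnit hδ]; exact continuous_clampUnit.comp (by fun_prop)
    rw [e1]
    refine cfc_mono fun t _ => ?_
    have hc0 : 0 ≤ chi δ t := by rw [chi_eq_clampUnit hδ]; exact clampUnit_nonneg _
    rcases le_or_gt t (-d) with ht | ht
    · simpa [hrlow t ht] using hc0
    rcases le_or_gt d t with ht' | ht'
    · simpa [hrhigh t ht'] using hc0
    · have h1 : chi δ t = 1 := if_pos ((abs_lt.mpr ⟨ht, ht'⟩).trans_le hdδ)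
      rw [h1]
      nlinarith [hr0 t, hr1 t]
  exact ⟨hp0, hp1, hgp, hlow, hhigh, hpp⟩

/-- The approximate spectral projection of `F` at level `3` produced by Property (S): a positive
contraction of `A` that is nearly a projection and whose traces are squeezed between those of
cut-offs of `F`. -/
lemma exists_almost_projection (hS : PropertyS A) (F : C(X, ℝ)) {ε : ℝ} (hε : 0 < ε) :
    ∃ p : A, 0 ≤ p ∧ ‖p‖ ≤ 1 ∧ ∀ τ ∈ tracialStates A,
      (τ (p - p * p)).re ≤ ε ∧
      (τ p).re ≤ traceFun e τ (clamp (F - .const X 1)) + 2 * ε ∧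
      traceFun e τ (clamp (F - .const X 4)) ≤ (τ p).re + 2 * ε := by
  obtain ⟨g, hg, hfg, δ, hδ, hchi⟩ :=
    hS (realEmb e (F - .const X 3)) (isSelfAdjoint_realEmb e _) ε hε
  set f := realEmb e (F - .const X 3) with hf
  -- `d ≤ δ` keeps the ramp where `chi δ = 1`; `d ≤ 1 / 2` leaves a spectral gap of at least `1 / 2`
  -- in both separation estimates, hence the bound `2 * ε`.
  obtain ⟨d, hd0, hd2, hdδ⟩ : ∃ d : ℝ, 0 < d ∧ d ≤ 1 / 2 ∧ d ≤ δ :=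
    ⟨min δ (1 / 2), by positivity, min_le_right _ _, min_le_left _ _⟩
  obtain ⟨r, hr, hr0, hr1, hrlow, hrhigh⟩ : ∃ r : ℝ → ℝ, Continuous r ∧ (∀ t, 0 ≤ r t) ∧
      (∀ t, r t ≤ 1) ∧ (∀ t, t ≤ -d → r t = 0) ∧ ∀ t, d ≤ t → r t = 1 :=
    ⟨fun t => clampUnit ((t + d) / (2 * d)), continuous_clampUnit.comp (by fun_prop),
      fun t => clampUnit_nonneg _, fun t => clampUnit_le_one _,
      fun t ht => clampUnit_of_nonpos
        (div_nonpos_of_nonpos_of_nonneg (by linarith) (by positivity)),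
      fun t ht => clampUnit_of_one_le ((one_le_div (by positivity)).mpr (by linarith))⟩
  obtain ⟨hp0, hp1, hgp, hlow, hhigh, hpp⟩ := cfc_ramp hg hr hr0 hr1 hrlow hrhigh hδ hdδ
  set p := cfc r g
  have hpn : ‖p‖ ≤ 1 := (CStarAlgebra.norm_le_one_iff_of_nonneg _ hp0).mpr hp1
  have hq0 : 0 ≤ 1 - p := sub_nonneg.mpr hp1
  have hqn : ‖1 - p‖ ≤ 1 := (CStarAlgebra.norm_le_one_iff_of_nonneg _ hq0).mpr (by simpa using hp0)
  have hgq : g * (1 - p) = (1 - p) * g := by rw [mul_sub, sub_mul, hgp]; simp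
  refine ⟨p, hp0, hpn, fun τ hτ => ⟨(trace_re_mono hτ hpp).trans (hchi τ hτ).le, ?_, ?_⟩⟩
  · set K := clamp (F - .const X 1)
    have hK0 : 0 ≤ 1 - K := sub_nonneg.mpr (clamp_le_one _)
    have hK1 : 1 - K ≤ 1 := sub_le_self _ (clamp_nonneg _)
    -- `p` lives where `g ≥ -d`, and `1 - K` where `F - 3 ≤ -1`.
    have hsep := traceNorm_mul_le_of_separated hτ (f := g) (g := f) (l := -d) (m := -1)
      hp0.isSelfAdjoint (isSelfAdjoint_realEmb e (1 - K)) hpn (norm_realEmb_le_one e hK0 hK1)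
      hgp (realEmb_mul_comm e _ _) hlow (by
        rw [← map_mul, ← map_mul, ← map_mul, ← map_smul]
        refine realEmb_mono e fun x => ?_
        change (1 - K x) * (F x - 3) * (1 - K x) ≤ -1 * ((1 - K x) * (1 - K x))
        rcases le_total (F x) 2 with h | h
        · nlinarith [mul_self_nonneg (1 - K x)]
        · rw [show K x = 1 from clampUnit_of_one_le (by simp; linarith)]; simp)
    rw [traceNorm_sub_comm] at hsep
    have hN := traceNorm_lt_of_uniform hτ hfg
    have h1 := (Complex.re_le_norm _).trans (norm_trace_le hτ (p * realEmb e (1 - K)))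
    have h2 := trace_mul_re_nonneg hτ hq0 (realEmb_nonneg e (clamp_nonneg (F - .const X 1)))
    have h3 := traceNorm_nonneg (τ := τ) (p * realEmb e (1 - K))
    have h4 : traceNorm τ (p * realEmb e (1 - K)) ≤ 2 * ε := by nlinarith
    rw [map_sub, map_one, mul_sub, mul_one, map_sub, Complex.sub_re] at h1
    rw [sub_mul, one_mul, map_sub, Complex.sub_re] at h2
    rw [map_sub, map_one, mul_sub, mul_one] at h4
    rw [traceFun_apply]
    linarith
  · set K := clamp (F - .const X 4)
    -- `K` lives where `F - 3 ≥ 1`, and `1 - p` where `g ≤ d`.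
    have hsep := traceNorm_mul_le_of_separated hτ (f := f) (g := g) (l := 1) (m := d)
      (isSelfAdjoint_realEmb e K) hq0.isSelfAdjoint
      (norm_realEmb_le_one e (clamp_nonneg _) (clamp_le_one _)) hqn
      (realEmb_mul_comm e _ _) hgq (by
        rw [← map_mul, ← map_mul, ← map_mul, ← map_smul]
        refine realEmb_mono e fun x => ?_
        change 1 * (K x * K x) ≤ K x * (F x - 3) * K x
        rcases le_total 4 (F x) with h | h
        · nlinarith [mul_self_nonneg (K x)]
        · rw [show K x = 0 from clampUnit_of_nonpos (by simp; linarith)]; simp) hhigh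
    have hN := traceNorm_lt_of_uniform hτ hfg
    have h1 := (Complex.re_le_norm _).trans (norm_trace_le hτ (realEmb e K * (1 - p)))
    have h2 := trace_mul_re_nonneg hτ
      (realEmb_nonneg e (sub_nonneg.mpr (clamp_le_one (F - .const X 4)))) hp0
    have h3 := traceNorm_nonneg (τ := τ) (realEmb e K * (1 - p))
    have h4 : traceNorm τ (realEmb e K * (1 - p)) ≤ 2 * ε := by nlinarith
    rw [mul_sub, mul_one, map_sub, Complex.sub_re] at h1
    rw [map_sub, map_one, sub_mul, one_mul, map_sub, Complex.sub_re] at h2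
    rw [mul_sub, mul_one] at h4
    rw [traceFun_apply]
    linarith

lemma applyUnit_eq {a : A} (h0 : 0 ≤ a) (h1 : ‖a‖ ≤ 1) (f : C(unitInterval, ℂ)) {G : ℂ → ℂ}
    (hG : ∀ t : unitInterval, f t = G (t : ℝ)) : applyUnit f a = cfc G a := by
  refine cfc_congr fun z hz => ?_
  have hzr : z = (z.re : ℂ) := h0.isSelfAdjoint.mem_spectrum_eq_re hz
  have hz0 : 0 ≤ z.re := by
    rw [hzr] at hz
    exact spectrum_nonneg_of_nonneg h0 ((spectrum.algebraMap_mem_iff ℂ).mp hz)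
  have : Nontrivial A := by
    by_contra h
    rw [not_nontrivial_iff_subsingleton] at h
    simp [spectrum.of_subsingleton] at hz
  have hz1 : z.re ≤ 1 := (Complex.re_le_norm z).trans ((spectrum.norm_le_norm_of_mem hz).trans h1)
  rw [Set.IccExtend_of_mem _ _ ⟨hz0, hz1⟩, hG]
  exact congrArg G hzr.symm

/-- Property (E) for the test functions `t` and `t - t²`. -/
lemma PropertyE.exists_realEmb (hE : PropertyE D) {p : A} (h0 : 0 ≤ p) (h1 : ‖p‖ ≤ 1)
    {ε : ℝ} (hε : 0 < ε) :
    ∃ B : C(X, ℝ), 0 ≤ B ∧ B ≤ 1 ∧ ∀ τ ∈ tracialStates A,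
      |(τ p).re - traceFun e τ B| < ε ∧
      |(τ (p - p * p)).re - traceFun e τ (B - B * B)| < ε := by
  let f₁ : C(unitInterval, ℂ) := ⟨fun t => ((t : ℝ) : ℂ), by fun_prop⟩
  let f₂ : C(unitInterval, ℂ) :=
    ⟨fun t => ((t : ℝ) : ℂ) - ((t : ℝ) : ℂ) * ((t : ℝ) : ℂ), by fun_prop⟩
  have e1 : ∀ {a : A}, 0 ≤ a → ‖a‖ ≤ 1 → applyUnit f₁ a = a := fun {a} h0 h1 => by
    rw [applyUnit_eq h0 h1 f₁ (G := fun z => z) fun t => rfl, cfc_id' ℂ a]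
  have e2 : ∀ {a : A}, 0 ≤ a → ‖a‖ ≤ 1 → applyUnit f₂ a = a - a * a := fun {a} h0 h1 => by
    rw [applyUnit_eq h0 h1 f₂ (G := fun z => z - z * z) fun t => rfl,
      cfc_sub (fun z => z) (fun z => z * z) a, cfc_mul (fun z => z) (fun z => z) a, cfc_id' ℂ a]
  classical
  obtain ⟨b, hbD, hb0, hb1, hb⟩ := hE p h0 h1 {f₁, f₂} ε hε
  obtain ⟨B, hB0, hB1, rfl⟩ := exists_realEmb_eq e hbD hb0 hb1
  refine ⟨B, hB0, hB1, fun τ hτ => ⟨?_, ?_⟩⟩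
  · have := (Complex.abs_re_le_norm _).trans_lt (hb f₁ (by simp) τ hτ)
    rwa [e1 h0 h1, e1 hb0 hb1, Complex.sub_re] at this
  · have := (Complex.abs_re_le_norm _).trans_lt (hb f₂ (by simp) τ hτ)
    rwa [e2 h0 h1, e2 hb0 hb1, Complex.sub_re, ← map_mul, ← map_sub (realEmb e)] at this

omit [PartialOrder A] [StarOrderedRing A] in
lemma exists_traceNorm_lt_of_dist {a : A} {S : Set A} (hS : S.Nonempty) {ε : ℝ}
    (h : uniformTraceDist a S < ε) : ∃ s ∈ S, uniformTraceNorm (tracialStates A) (a - s) < ε := by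
  have := hS.to_subtype
  obtain ⟨s, hs⟩ := exists_lt_of_ciInf_lt h
  exact ⟨s.1, s.2, hs⟩

omit [PartialOrder A] [StarOrderedRing A] in
lemma mul_eq_zero_of_mem_herClosure {w g b : A} (hw : w * g = 0)
    (hb : b ∈ herClosure g (Set.univ : Set A)) : w * b = 0 := by
  have hcl : IsClosed {b : A | w * b = 0} := isClosed_eq (by fun_prop) continuous_const
  refine closure_minimal ?_ hcl hb
  rintro _ ⟨x, -, rfl⟩
  change w * (g * x * g) = 0
  rw [← mul_assoc, ← mul_assoc, hw, zero_mul, zero_mul]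

/-- Property (C) with `h = 1`, moving an almost projection under the open support of `G`. -/
lemma PropertyC.exists_realEmb (hC : PropertyC D) {B G : C(X, ℝ)} (hB0 : 0 ≤ B) (hB1 : B ≤ 1)
    (hG0 : 0 ≤ G) (hG1 : G ≤ 1) {ε : ℝ} (hε : 0 < ε)
    (hBB : ∀ τ ∈ tracialStates A, traceFun e τ (B - B * B) ≤ ε ^ 2)
    (hrank : ∀ τ ∈ tracialStates A,
      rankFunction τ (realEmb e B) < rankFunction τ (realEmb e G)) :
    ∃ Q : C(X, ℝ), 0 ≤ Q ∧ Q ≤ 1 ∧ ∀ τ ∈ tracialStates A,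
      traceFun e τ (Q - Q * Q) ≤ 14 * ε ∧ traceFun e τ B ≤ traceFun e τ Q + 5 * ε ∧
      ∀ W : C(X, ℝ), 0 ≤ W → W ≤ 1 → W * G = 0 → traceFun e τ (W * Q) ≤ 5 * ε := by
  have hher : ∀ F : C(X, ℝ), realEmb e F ∈ herClosure 1 (D : Set A) := fun F =>
    subset_closure ⟨realEmb e F, realEmb_mem e F, by simp⟩
  set b := realEmb e B with hb
  have hbn : ‖b‖ ≤ 1 := norm_realEmb_le_one e hB0 hB1
  obtain ⟨u, hu, -, ⟨c, hc, huc⟩, hD, -, huu⟩ := hC b (realEmb e G) 1 (realEmb_mem e B)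
    (realEmb_mem e G) (one_mem D) (realEmb_nonneg e hB0) hbn (realEmb_nonneg e hG0)
    (norm_realEmb_le_one e hG0 hG1) zero_le_one
    (by simpa using norm_realEmb_le_one e (zero_le_one (α := C(X, ℝ))) le_rfl)
    (hher B) (hher G) hrank ε hε
  have hsu : ‖star u‖ ≤ 1 := by rwa [norm_star]
  obtain ⟨d, ⟨hdD, hdn⟩, hd⟩ := exists_traceNorm_lt_of_dist
    (S := contractions D) ⟨0, zero_mem D, by simp⟩ (hD b ⟨realEmb_mem e B, hbn⟩).1
  -- The nearby contraction `d` need not be positive. Since `q` is almost a projection, `d* d` is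
  -- close to `q* q`, hence to `q`.
  obtain ⟨Q, hQ0, hQ1, hQ⟩ := exists_realEmb_eq e (b := star d * d)
    (mul_mem (star_mem hdD) hdD) (star_mul_self_nonneg d)
    (by rw [CStarRing.norm_star_mul_self]; nlinarith [norm_nonneg d])
  set q := u * b * star u with hq
  have hsb : star b = b := (isSelfAdjoint_realEmb e B).star_eq
  have hsq : star q = q := by rw [hq]; simp [hsb, mul_assoc]
  have hqn : ‖q‖ ≤ 1 := by
    calc ‖q‖ ≤ ‖u * b‖ * ‖star u‖ := norm_mul_le _ _
      _ ≤ ‖u‖ * ‖b‖ * ‖star u‖ := by gcongr; exact norm_mul_le _ _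
      _ ≤ 1 * 1 * 1 := by gcongr
      _ = 1 := by norm_num
  refine ⟨Q, hQ0, hQ1, fun τ hτ => ?_⟩
  have hqd : traceNorm τ (q - d) < ε := traceNorm_lt_of_uniform hτ hd
  have hqc : traceNorm τ (q - c) < ε := traceNorm_lt_of_uniform hτ huc
  have huu' : traceNorm τ (star u * u - 1) < ε := traceNorm_lt_of_uniform hτ huu
  have hcontr : ∀ {x y z : A}, ‖x‖ ≤ 1 → ‖z‖ ≤ 1 → traceNorm τ (x * y * z) ≤ traceNorm τ y := by
    intro x y z hx hz
    have h1 := traceNorm_mul_le' hτ z (x * y)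
    have h2 := traceNorm_mul_le hτ x y
    have h3 := traceNorm_nonneg (τ := τ) y
    have h4 := traceNorm_nonneg (τ := τ) (x * y)
    nlinarith [norm_nonneg x, norm_nonneg z]
  have hbb : traceNorm τ (b - b * b) ≤ ε := by
    refine abs_le_of_sq_le_sq' ?_ hε.le |>.2
    rw [traceNorm_sq hτ]
    refine le_trans ?_ (hBB τ hτ)
    rw [hb, ← map_mul, ← map_sub (realEmb e), (isSelfAdjoint_realEmb e _).star_eq, ← map_mul]
    refine traceFun_mono e hτ fun x => ?_
    change (B x - B x * B x) * (B x - B x * B x) ≤ B x - B x * B x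
    have h0 : 0 ≤ B x := hB0 x
    have h1 : B x ≤ 1 := hB1 x
    nlinarith [mul_nonneg h0 (sub_nonneg.mpr h1)]
  have hqq : traceNorm τ (q - star q * q) ≤ 2 * ε := by
    have e1 : q - star q * q = u * ((b - b * b) - b * (star u * u - 1) * b) * star u := by
      rw [hsq, hq]; noncomm_ring
    rw [e1]
    refine (hcontr hu hsu).trans ?_
    rw [sub_eq_add_neg]
    refine (traceNorm_add_le hτ _ _).trans ?_
    rw [traceNorm_neg]
    have := hcontr (y := star u * u - 1) hbn hbn
    linarith
  have hqQ : traceNorm τ (q - realEmb e Q) ≤ 4 * ε := by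
    have h1 := traceNorm_sub_le hτ q (star q * q) (realEmb e Q)
    have h2 := traceNorm_star_mul_self_sub_le hτ hqn hdn
    rw [hQ] at h1 ⊢
    linarith
  have hQn : ‖realEmb e Q‖ ≤ 1 := norm_realEmb_le_one e hQ0 hQ1
  refine ⟨?_, ?_, fun W hW0 hW1 hWG => ?_⟩
  · rw [traceFun_apply]
    refine (Complex.re_le_norm _).trans ((norm_trace_le hτ _).trans ?_)
    have h1 := traceNorm_sub_le hτ (realEmb e Q) q (star q * q)
    have h2 := traceNorm_sub_le hτ (realEmb e Q) (star q * q)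
      (star (realEmb e Q) * realEmb e Q)
    have h3 := traceNorm_star_mul_self_sub_le hτ hqn hQn
    rw [(isSelfAdjoint_realEmb e Q).star_eq] at h2 h3
    rw [traceNorm_sub_comm] at h1
    rw [map_sub, map_mul]
    rw [traceNorm_sub_comm] at h1
    rw [traceNorm_sub_comm q] at hqQ
    linarith [traceNorm_sub_comm (τ := τ) q (realEmb e Q)]
  · rw [traceFun_apply, traceFun_apply, ← hb]
    have h1 := trace_re_le_add hτ q (realEmb e Q)
    have h2 := trace_re_le_add hτ b (b * (star u * u))
    have h3 : τ q = τ (b * (star u * u)) := by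
      rw [hq, mul_assoc, trace_mul_comm hτ, mul_assoc]
    have h4 : traceNorm τ (b - b * (star u * u)) ≤ ε := by
      have := hcontr (x := b) (y := star u * u - 1) (z := 1) hbn (by
        simpa using norm_realEmb_le_one e (zero_le_one (α := C(X, ℝ))) le_rfl)
      rw [mul_one, mul_sub, mul_one, traceNorm_sub_comm] at this
      linarith
    rw [← h3] at h2
    linarith
  · have hWn : ‖realEmb e W‖ ≤ 1 := norm_realEmb_le_one e hW0 hW1
    have hWc : realEmb e W * c = 0 :=
      mul_eq_zero_of_mem_herClosure (by rw [← map_mul, hWG, map_zero]) hc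
    rw [traceFun_apply]
    refine (Complex.re_le_norm _).trans ((norm_trace_le hτ _).trans ?_)
    have e1 : realEmb e (W * Q) = realEmb e W * (realEmb e Q - c) := by
      rw [mul_sub, hWc, map_mul, sub_zero]
    rw [e1]
    have h1 := traceNorm_mul_le hτ (realEmb e W) (realEmb e Q - c)
    have h2 := traceNorm_sub_le hτ (realEmb e Q) q c
    rw [traceNorm_sub_comm (realEmb e Q) q] at h2
    nlinarith [traceNorm_nonneg (τ := τ) (realEmb e Q - c)]

/-- For every `F` there is an element of `D`, nearly a projection, that lies almost under the set
`{F > 0}` and whose traces almost dominate those of `{F ≥ 5}`. -/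
lemma exists_almost_indicator (hA : IsSimpleCStar A) (hC : PropertyC D) (hE : PropertyE D)
    (hS : PropertyS A) (F : C(X, ℝ)) {ε : ℝ} (hε : 0 < ε) :
    ∃ Q : C(X, ℝ), 0 ≤ Q ∧ Q ≤ 1 ∧ ∀ τ ∈ tracialStates A,
      traceFun e τ (Q - Q * Q) ≤ ε ∧ traceFun e τ (clamp (-F) * Q) ≤ ε ∧
      traceFun e τ (clamp (F - .const X 4)) ≤ traceFun e τ Q + ε := by
  set G := clamp F
  set K := clamp (F - .const X 1)
  have hG0 : 0 ≤ G := clamp_nonneg _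
  have hG1 : G ≤ 1 := clamp_le_one _
  have hKG : K ≤ G := fun x => monotone_clampUnit (by simp)
  have hWG : clamp (-F) * G = 0 := by
    ext x
    change clampUnit (-F x) * clampUnit (F x) = 0
    rcases le_total (F x) 0 with h | h
    · rw [clampUnit_of_nonpos h, mul_zero]
    · rw [clampUnit_of_nonpos (neg_nonpos.mpr h), zero_mul]
  -- If the gap vanishes, `F` takes no value in `(0, 2)` and `G` is already a projection. Otherwise
  -- the gap supplies the room for the strict rank inequality.
  by_cases hgap : G - K = 0
  · have hGG : G - G * G = 0 := by
      ext x
      change clampUnit (F x) - clampUnit (F x) * clampUnit (F x) = 0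
      have hx : clampUnit (F x) - clampUnit (F x - 1) = 0 := congrArg (fun f : C(X, ℝ) => f x) hgap
      rcases le_total (F x) 0 with h | h
      · rw [clampUnit_of_nonpos h]; simp
      rcases le_total 1 (F x) with h' | h'
      · rw [clampUnit_of_one_le h']; simp
      · rw [clampUnit_of_nonpos (t := F x - 1) (by linarith)] at hx
        rw [sub_zero] at hx
        rw [hx]; simp
    refine ⟨G, hG0, hG1, fun τ hτ => ⟨?_, ?_, ?_⟩⟩
    · rw [hGG, map_zero]; exact hε.le
    · rw [hWG, map_zero]; exact hε.le
    · have := traceFun_mono e hτ (F := clamp (F - .const X 4)) (G := G)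
        fun x => monotone_clampUnit (by simp)
      linarith
  obtain ⟨κ, hκ, hκN⟩ := exists_pos_le_traceNorm hA
    (k := realEmb e (G - K)) (fun h => hgap (realEmb_injective e (h.trans (map_zero _).symm)))
  have hgapτ : ∀ τ ∈ tracialStates A, κ ^ 2 ≤ traceFun e τ (G - K) := fun τ hτ => by
    refine (pow_le_pow_left₀ hκ.le (hκN τ hτ) 2).trans ?_
    rw [traceNorm_sq hτ, (isSelfAdjoint_realEmb e _).star_eq, ← map_mul]
    refine traceFun_mono e hτ fun x => ?_
    change (G x - K x) * (G x - K x) ≤ G x - K x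
    have h1 : K x ≤ G x := hKG x
    have h2 : G x ≤ 1 := hG1 x
    have h3 : 0 ≤ K x := clampUnit_nonneg _
    nlinarith
  obtain ⟨η, hη, hη1, hηε⟩ : ∃ η : ℝ, 0 < η ∧ η ≤ 1 ∧ 20 * η ≤ ε :=
    ⟨min 1 (ε / 20), by positivity, min_le_left _ _, by linarith [min_le_right 1 (ε / 20)]⟩
  -- `4 * θ ≤ η ^ 2` is the almost-projection bound required of `B₁`. The rank of `B₁` exceeds the
  -- trace of `K` by less than `7 * θ`, and the trace of `G` exceeds it by at least `κ ^ 2`.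
  obtain ⟨θ, hθ, hθη, hθκ⟩ : ∃ θ : ℝ, 0 < θ ∧ 4 * θ ≤ η ^ 2 ∧ 8 * θ ≤ κ ^ 2 :=
    ⟨min (η ^ 2 / 4) (κ ^ 2 / 8), by positivity,
      by linarith [min_le_left (η ^ 2 / 4) (κ ^ 2 / 8)],
      by linarith [min_le_right (η ^ 2 / 4) (κ ^ 2 / 8)]⟩
  obtain ⟨p, hp0, hp1, hp⟩ := exists_almost_projection e hS F hθ
  obtain ⟨B, hB0, hB1, hB⟩ := hE.exists_realEmb e hp0 hp1 hθ
  -- `B` may have large support where it is tiny. Its cut-off lives on `{B > 1/2}`, where `1 ≤ B + 2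
  -- (B - B²)`, so its rank is almost bounded by the trace of `B`.
  set B₁ := clamp (B + B - 1)
  have hB₁0 : 0 ≤ B₁ := clamp_nonneg _
  have hB₁1 : B₁ ≤ 1 := clamp_le_one _
  have hB₁x : ∀ x, B₁ x = max 0 (2 * B x - 1) := fun x => by
    change clampUnit (B x + B x - 1) = _
    have : B x ≤ 1 := hB1 x
    unfold clampUnit
    rw [min_eq_right (by linarith)]
    congr 1; ring
  have hBx0 : ∀ x, 0 ≤ B x := fun x => hB0 x
  have hBx1 : ∀ x, B x ≤ 1 := fun x => hB1 x
  have hBB : ∀ τ ∈ tracialStates A, traceFun e τ (B - B * B) ≤ 2 * θ := fun τ hτ => by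
    have h1 := (abs_lt.mp (hB τ hτ).2).1
    have h2 := (hp τ hτ).1
    linarith
  have hBB₁ : ∀ τ ∈ tracialStates A, traceFun e τ (B₁ - B₁ * B₁) ≤ 4 * θ := fun τ hτ => by
    have h1 := traceFun_mono e hτ (F := B₁ - B₁ * B₁) (G := (B - B * B) + (B - B * B)) fun x => by
      change B₁ x - B₁ x * B₁ x ≤ (B x - B x * B x) + (B x - B x * B x)
      rw [hB₁x]
      rcases max_cases 0 (2 * B x - 1) with ⟨h, h'⟩ | ⟨h, h'⟩ <;> rw [h] <;>
        nlinarith [hBx0 x, hBx1 x]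
    rw [map_add] at h1
    linarith [hBB τ hτ]
  have hB₁B : ∀ τ ∈ tracialStates A, traceFun e τ B ≤ traceFun e τ B₁ + 4 * θ := fun τ hτ => by
    have h1 := traceFun_mono e hτ (F := B) (G := B₁ + ((B - B * B) + (B - B * B))) fun x => by
      change B x ≤ B₁ x + ((B x - B x * B x) + (B x - B x * B x))
      rw [hB₁x]
      rcases max_cases 0 (2 * B x - 1) with ⟨h, h'⟩ | ⟨h, h'⟩ <;> rw [h] <;>
        nlinarith [hBx0 x, hBx1 x]
    rw [map_add, map_add] at h1
    linarith [hBB τ hτ]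
  have hrank : ∀ τ ∈ tracialStates A,
      rankFunction τ (realEmb e B₁) < rankFunction τ (realEmb e G) := fun τ hτ => by
    have h1 := rankFunction_le e hτ (K := B + ((B - B * B) + (B - B * B))) hB₁0 hB₁1
      (fun x => by
        change 0 ≤ B x + ((B x - B x * B x) + (B x - B x * B x))
        nlinarith [hBx0 x, hBx1 x])
      (fun x hx => by
        change 1 ≤ B x + ((B x - B x * B x) + (B x - B x * B x))
        rw [hB₁x] at hx
        have : 0 < 2 * B x - 1 := by simpa using hx
        nlinarith [hBx1 x])
    have h2 := le_rankFunction e hτ hG0 hG1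
    have h3 := hgapτ τ hτ
    have h4 := (abs_lt.mp (hB τ hτ).1).1
    have h5 := (hp τ hτ).2.1
    rw [map_add, map_add] at h1
    rw [map_sub] at h3
    linarith [hBB τ hτ]
  obtain ⟨Q, hQ0, hQ1, hQ⟩ := hC.exists_realEmb e hB₁0 hB₁1 hG0 hG1 hη
    (fun τ hτ => (hBB₁ τ hτ).trans hθη) hrank
  refine ⟨Q, hQ0, hQ1, fun τ hτ => ?_⟩
  obtain ⟨hQ2, hQ3, hQ4⟩ := hQ τ hτ
  have hQ5 := hQ4 _ (clamp_nonneg (-F)) (clamp_le_one _) hWG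
  refine ⟨by linarith, by linarith, ?_⟩
  have h1 := (hp τ hτ).2.2
  have h2 := (abs_lt.mp (hB τ hτ).1).2
  have h3 := hB₁B τ hτ
  nlinarith

end Core

/-! ### Stacking unit slices and rounding sums. -/

lemma sum_clampUnit_sub (N : ℕ) (y : ℝ) :
    ∑ i ∈ Finset.range N, clampUnit (y - i) = max 0 (min (N : ℝ) y) := by
  induction N with
  | zero => simp
  | succ N ih =>
    have hN : (0 : ℝ) ≤ N := N.cast_nonneg
    rw [Finset.sum_range_succ, ih]
    push_cast
    unfold clampUnit
    rcases le_total y 0 with h | h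
    · rw [min_eq_right (by linarith), min_eq_right (by linarith), min_eq_right (by linarith),
        max_eq_left h, max_eq_left (by linarith), add_zero]
    rcases le_total y N with h' | h'
    · rw [min_eq_right h', min_eq_right (by linarith), min_eq_right (by linarith),
        max_eq_left (by linarith : y - N ≤ 0), add_zero]
    rw [min_eq_left h', max_eq_right hN]
    rcases le_total y (N + 1) with h'' | h''
    · rw [min_eq_right (by linarith), min_eq_right h'', max_eq_right h, max_eq_right (by linarith)]
      ring
    · rw [min_eq_left (by linarith), min_eq_left h'', max_eq_right (by linarith),
        max_eq_right (by linarith)]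

/-- A sum of numbers in `[0,1]` is close to an integer if all of them are close to `{0,1}`. -/
lemma exists_int_abs_sum_sub_le (N : ℕ) {q : ℕ → ℝ} (h0 : ∀ i, 0 ≤ q i) (h1 : ∀ i, q i ≤ 1) :
    ∃ m : ℤ, |∑ i ∈ Finset.range N, q i - m| ≤
      2 * ∑ i ∈ Finset.range N, (q i - q i * q i) := by
  induction N with
  | zero => exact ⟨0, by simp⟩
  | succ N ih =>
    obtain ⟨m, hm⟩ := ih
    rw [Finset.sum_range_succ, Finset.sum_range_succ]
    rw [abs_le] at hm
    -- Round each term to the nearer of `0` and `1`: the error `min q (1 - q)` is at most `2 (q -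
    -- q²)`.
    rcases le_total (q N) (1 / 2) with h | h
    · refine ⟨m, abs_le.mpr ⟨?_, ?_⟩⟩ <;> nlinarith [h0 N, h1 N]
    · refine ⟨m + 1, abs_le.mpr ⟨?_, ?_⟩⟩ <;> push_cast <;> nlinarith [h0 N, h1 N]

lemma le_sum_of_abs_sum_sub_half_lt (N : ℕ) {q : ℕ → ℝ} (h0 : ∀ i, 0 ≤ q i) (h1 : ∀ i, q i ≤ 1)
    (n : ℕ) (h : |∑ i ∈ Finset.range N, q i - (n + 1 / 2)| < 1 / 4) :
    1 / 8 ≤ ∑ i ∈ Finset.range N, (q i - q i * q i) := by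
  obtain ⟨m, hm⟩ := exists_int_abs_sum_sub_le N h0 h1
  by_contra! hlt
  rw [abs_lt] at h
  rw [abs_le] at hm
  have h2 : ((n : ℤ) : ℝ) < m := by push_cast; linarith
  have h3 : (m : ℝ) < ((n + 1 : ℤ) : ℝ) := by push_cast; linarith
  have h4 := Int.cast_lt.mp h2
  have h5 := Int.cast_lt.mp h3
  omega

/-! ### Averaging over many levels. -/

section Averaging

variable {X : Type*} [TopologicalSpace X]

/-- If the level sets of continuous functions are approximated, one-sidedly and in total mass, by
almost projections, then every continuous function is uniformly approximated by functions whose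
zero set has a neighbourhood that is uniformly small for all functionals in `Φ`. -/
lemma exists_small_near_zero {Φ : Set (C(X, ℝ) →ₗ[ℝ] ℝ)}
    (hpos : ∀ φ ∈ Φ, ∀ F : C(X, ℝ), 0 ≤ F → 0 ≤ φ F) (hone : ∀ φ ∈ Φ, φ 1 = 1)
    (H : ∀ (F : C(X, ℝ)) (ε : ℝ), 0 < ε → ∃ Q : C(X, ℝ), 0 ≤ Q ∧ Q ≤ 1 ∧ ∀ φ ∈ Φ,
      φ (Q - Q * Q) ≤ ε ∧ φ (clamp (-F) * Q) ≤ ε ∧ φ (clamp (F - .const X 4)) ≤ φ Q + ε)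
    (F₀ : C(X, ℝ)) {η ε : ℝ} (hη : 0 < η) (hε : 0 < ε) :
    ∃ f : C(X, ℝ), (∀ x, |f x - F₀ x| ≤ η) ∧ ∃ δ : ℝ, 0 < δ ∧ ∃ Z : C(X, ℝ), 0 ≤ Z ∧
      (∀ x, |f x| < δ → 1 ≤ Z x) ∧ ∀ φ ∈ Φ, φ Z ≤ ε := by
  -- The `8` is the bound for the mean of `(P + E - S) + E`: the level shift costs `5`, and three
  -- error sums cost at most `N * θ ≤ 1` each.
  obtain ⟨C, hC, hCε⟩ : ∃ C : ℝ, 0 < C ∧ C⁻¹ * 8 ≤ ε / 2 :=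
    ⟨16 / ε, by positivity, by rw [inv_div]; linarith⟩
  obtain ⟨n, hn⟩ := exists_nat_ge (C + 2)
  set N := 2 * n + 1 with hN
  have hN0 : (0 : ℝ) < N := by positivity
  obtain ⟨θ, hθ, hθ1, hθε⟩ : ∃ θ : ℝ, 0 < θ ∧ N * θ ≤ 1 ∧ N * θ ≤ ε / 16 :=
    ⟨min (1 / N) (ε / 16 / N), by positivity,
      (mul_le_mul_of_nonneg_left (min_le_left _ _) hN0.le).trans_eq (by field_simp),
      (mul_le_mul_of_nonneg_left (min_le_right _ _) hN0.le).trans_eq (by field_simp)⟩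
  set c := C / η with hc
  have hc0 : 0 < c := by positivity
  -- The levels are offset so that `P` equals `n + 1 / 2` at zeros of `F₀`, as far as possible from
  -- the integers. The choice of `n` keeps `P` unclipped wherever `|c F₀| ≤ C + 1 / 4`.
  let L : ℕ → C(X, ℝ) := fun i => c • F₀ + .const X (n - 1 / 2 - i)
  choose Q hQ0 hQ1 hQ using fun i => H (L i) θ hθ
  have hq0 : ∀ i x, 0 ≤ Q i x := fun i x => hQ0 i x
  have hq1 : ∀ i x, Q i x ≤ 1 := fun i x => hQ1 i x
  let W : ℕ → C(X, ℝ) := fun i => clamp (-L i)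
  let S : C(X, ℝ) := ∑ i ∈ Finset.range N, Q i
  let E : C(X, ℝ) := ∑ i ∈ Finset.range N, W i * Q i
  let E₂ : C(X, ℝ) := ∑ i ∈ Finset.range N, (Q i - Q i * Q i)
  let P : C(X, ℝ) := ∑ i ∈ Finset.range N, (1 - W i)
  let P' : C(X, ℝ) := ∑ i ∈ Finset.range N, clamp (L i - .const X 4)
  have hW0 : ∀ i x, 0 ≤ W i x := fun i x => clampUnit_nonneg _
  have hW1 : ∀ i x, W i x ≤ 1 := fun i x => clampUnit_le_one _
  have hPx : ∀ x, P x = max 0 (min (N : ℝ) (n + 1 / 2 + c * F₀ x)) := fun x => by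
    rw [← sum_clampUnit_sub, ContinuousMap.sum_apply]
    refine Finset.sum_congr rfl fun i _ => ?_
    change 1 - clampUnit (-(c * F₀ x + (n - 1 / 2 - i))) = _
    unfold clampUnit
    grind
  have hP'x : ∀ x, P' x = max 0 (min (N : ℝ) (n + 1 / 2 + c * F₀ x - 5)) := fun x => by
    rw [← sum_clampUnit_sub, ContinuousMap.sum_apply]
    refine Finset.sum_congr rfl fun i _ => ?_
    change clampUnit (c * F₀ x + (n - 1 / 2 - i) - 4) = _
    congr 1; ring
  have hPP' : P ≤ P' + (5 : ℝ) • 1 := fun x => by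
    change P x ≤ P' x + 5 * 1
    rw [hPx, hP'x]
    grind
  have hE0 : 0 ≤ E := Finset.sum_nonneg fun i _ => fun x => mul_nonneg (hW0 i x) (hq0 i x)
  have hE₂0 : 0 ≤ E₂ := Finset.sum_nonneg fun i _ => fun x => by
    change 0 ≤ Q i x - Q i x * Q i x
    nlinarith [hq0 i x, hq1 i x]
  have hE₁0 : S ≤ P + E := by
    change _ ≤ ∑ i ∈ Finset.range N, (1 - W i) + ∑ i ∈ Finset.range N, W i * Q i
    rw [← Finset.sum_add_distrib]
    refine Finset.sum_le_sum fun i _ => fun x => ?_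
    change Q i x ≤ 1 - W i x + W i x * Q i x
    nlinarith [mul_nonneg (sub_nonneg.mpr (hW1 i x)) (sub_nonneg.mpr (hq1 i x))]
  let G : C(X, ℝ) := ⟨fun x => max (c * F₀ x - C) (min (S x - (n + 1 / 2)) (c * F₀ x + C)),
    by fun_prop⟩
  -- `E₂` detects summands far from `0` and `1`. The second term detects truncation: `P + E - S`
  -- when `S` is too small, the extra `E` when it is too large, since `S - P ≤ E`.
  let Z : C(X, ℝ) := (8 : ℝ) • E₂ + C⁻¹ • ((P + E - S) + E)
  have hCi : 0 < C⁻¹ := by positivity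
  refine ⟨c⁻¹ • G, fun x => ?_, c⁻¹ * (1 / 4), by positivity, Z, ?_, fun x hx => ?_, fun φ hφ => ?_⟩
  · have h1 : |G x - c * F₀ x| ≤ C := by
      change |max (c * F₀ x - C) (min (S x - (n + 1 / 2)) (c * F₀ x + C)) - c * F₀ x| ≤ C
      rw [abs_le]
      have h2 := le_max_left (c * F₀ x - C) (min (S x - (n + 1 / 2)) (c * F₀ x + C))
      have h3 : max (c * F₀ x - C) (min (S x - (n + 1 / 2)) (c * F₀ x + C)) ≤ c * F₀ x + C :=
        max_le (by linarith) (min_le_right _ _)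
      constructor <;> linarith
    have h2 : (c⁻¹ • G) x - F₀ x = c⁻¹ * (G x - c * F₀ x) := by
      change c⁻¹ * G x - F₀ x = _
      field_simp
    rw [h2, abs_mul, abs_of_pos (by positivity)]
    calc c⁻¹ * |G x - c * F₀ x| ≤ c⁻¹ * C := by gcongr
      _ = η := by rw [hc]; field_simp
  · intro x
    have h1 : 0 ≤ E₂ x := hE₂0 x
    have h2 : S x ≤ P x + E x := hE₁0 x
    have h3 : 0 ≤ E x := hE0 x
    change 0 ≤ 8 * E₂ x + C⁻¹ * ((P x + E x - S x) + E x)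
    have : 0 ≤ C⁻¹ * ((P x + E x - S x) + E x) := mul_nonneg hCi.le (by linarith)
    linarith
  · have hG : |G x| < 1 / 4 := by
      change |c⁻¹ * G x| < _ at hx
      rw [abs_mul, abs_of_pos (by positivity)] at hx
      exact lt_of_mul_lt_mul_left hx (by positivity)
    have h1 : 0 ≤ E₂ x := hE₂0 x
    have h2 : S x ≤ P x + E x := hE₁0 x
    have h3 : 0 ≤ E x := hE0 x
    have hGx : G x = max (c * F₀ x - C) (min (S x - (n + 1 / 2)) (c * F₀ x + C)) := rfl
    have hNn : (N : ℝ) = 2 * n + 1 := by rw [hN]; push_cast; ring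
    change 1 ≤ 8 * E₂ x + C⁻¹ * ((P x + E x - S x) + E x)
    have h0 : 0 ≤ C⁻¹ * ((P x + E x - S x) + E x) := mul_nonneg hCi.le (by linarith)
    have hbig : C ≤ (P x + E x - S x) + E x → 1 ≤ C⁻¹ * ((P x + E x - S x) + E x) := fun h => by
      calc 1 = C⁻¹ * C := by field_simp
        _ ≤ _ := by gcongr
    have hPy : |c * F₀ x| ≤ C + 1 / 4 → P x = n + 1 / 2 + c * F₀ x := fun h => by
      rw [abs_le] at h
      rw [hPx, hNn, min_eq_right (by linarith), max_eq_right (by linarith)]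
    rw [abs_lt] at hG
    rcases lt_or_ge (S x - (n + 1 / 2)) (c * F₀ x - C) with h | h
    · rw [min_eq_left (by linarith), max_eq_left h.le] at hGx
      have := hbig (by rw [hPy (abs_le.mpr ⟨by linarith, by linarith⟩)]; linarith)
      linarith
    rcases lt_or_ge (c * F₀ x + C) (S x - (n + 1 / 2)) with h' | h'
    · rw [min_eq_right h'.le, max_eq_right (by linarith)] at hGx
      have hP := hPy (abs_le.mpr ⟨by linarith, by linarith⟩)
      have := hbig (by linarith)
      linarith
    · rw [min_eq_left h', max_eq_right h] at hGx
      have hSx : S x = ∑ i ∈ Finset.range N, Q i x := ContinuousMap.sum_apply _ _ _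
      have hEx : E₂ x = ∑ i ∈ Finset.range N, (Q i x - Q i x * Q i x) :=
        ContinuousMap.sum_apply _ _ _
      have := le_sum_of_abs_sum_sub_half_lt N (fun i => hq0 i x) (fun i => hq1 i x) n (by
        rw [← hSx, ← hGx, abs_lt]; exact hG)
      rw [hEx] at *
      linarith
  · have hmono : ∀ {F G : C(X, ℝ)}, F ≤ G → φ F ≤ φ G := fun {F G} h => by
      have := hpos φ hφ _ (sub_nonneg.mpr h)
      rw [map_sub] at this
      linarith
    have hsum : ∀ {u : ℕ → C(X, ℝ)}, (∀ i, φ (u i) ≤ θ) →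
        φ (∑ i ∈ Finset.range N, u i) ≤ N * θ := fun {u} hu => by
      rw [map_sum]
      refine (Finset.sum_le_sum fun i _ => hu i).trans_eq ?_
      simp
    have h1 : φ E₂ ≤ N * θ := hsum fun i => (hQ i φ hφ).1
    have h2 : φ E ≤ N * θ := hsum fun i => (hQ i φ hφ).2.1
    have h3 : φ (P' - S) ≤ N * θ := by
      have e1 : P' - S = ∑ i ∈ Finset.range N, (clamp (L i - .const X 4) - Q i) := by
        rw [Finset.sum_sub_distrib]
      rw [e1]
      refine hsum fun i => ?_
      rw [map_sub]
      linarith [(hQ i φ hφ).2.2]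
    have h4 := hmono hPP'
    have e2 : φ Z = 8 * φ E₂ + C⁻¹ * ((φ P + φ E - φ S) + φ E) := by
      simp only [Z, map_add, map_sub, map_smul, smul_eq_mul]
    rw [map_sub] at h3
    rw [map_add, map_smul, hone φ hφ, smul_eq_mul] at h4
    have h5 : C⁻¹ * ((φ P + φ E - φ S) + φ E) ≤ C⁻¹ * 8 := by
      gcongr; linarith
    rw [e2]
    linarith

end Averaging

/-! ### Baire category. -/

section Baire

variable {X : Type*} [TopologicalSpace X] [CompactSpace X] [MeasurableSpace X]

/-- The small boundary property follows once every continuous function can be uniformly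
approximated by functions whose zero set has a neighbourhood of uniformly small measure. -/
lemma smallBoundaryProperty_of_dense [T2Space X] {Δ : Set (Measure X)}
    (h : ∀ (F : C(X, ℝ)) (η ε : ℝ), 0 < η → 0 < ε → ∃ f : C(X, ℝ), (∀ x, |f x - F x| ≤ η) ∧
      ∃ δ : ℝ, 0 < δ ∧ ∀ μ ∈ Δ, μ {x | |f x| < δ} ≤ ENNReal.ofReal ε) :
    SmallBoundaryProperty Δ := by
  intro x U hU hxU
  let O : ℕ → Set C(X, ℝ) := fun n =>
    {f | ∃ δ : ℝ, 0 < δ ∧ ∀ μ ∈ Δ, μ {x | |f x| < δ} ≤ ENNReal.ofReal (1 / (n + 1))}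
  have hO : ∀ n, IsOpen (O n) := fun n => by
    rw [Metric.isOpen_iff]
    rintro f ⟨δ, hδ, hf⟩
    refine ⟨δ / 2, by positivity, fun g hg => ⟨δ / 2, by positivity, fun μ hμ => ?_⟩⟩
    refine (measure_mono fun y hy => ?_).trans (hf μ hμ)
    have h1 := (ContinuousMap.dist_lt_iff (by positivity)).mp hg y
    rw [Real.dist_eq] at h1
    change |g y| < δ / 2 at hy
    change |f y| < δ
    rw [abs_lt] at *
    constructor <;> linarith
  have hd : ∀ n, Dense (O n) := fun n => by
    rw [Metric.dense_iff]
    intro F r hr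
    obtain ⟨f, hf, δ, hδ, hfδ⟩ := h F (r / 2) (1 / (n + 1)) (by positivity) (by positivity)
    refine ⟨f, ?_, δ, hδ, hfδ⟩
    rw [Metric.mem_ball, ContinuousMap.dist_lt_iff hr]
    intro y
    rw [Real.dist_eq]
    linarith [hf y]
  -- A function in all the `O n` has a zero set that is null for every `μ ∈ Δ` simultaneously.
  have hdense := dense_iInter_of_isOpen_nat hO hd
  obtain ⟨g, hg0, hg1, -⟩ := exists_continuous_zero_one_of_isClosed
    (isClosed_singleton (x := x)) hU.isClosed_compl
    (Set.disjoint_singleton_left.mpr fun hx => hx hxU)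
  -- `F` is `-1` at `x` and `1` off `U`, so any `f` within distance `1` is negative at `x` and
  -- positive off `U`.
  let F : C(X, ℝ) := g + g - 1
  obtain ⟨f, hfF, hfO⟩ := (Metric.dense_iff.mp hdense) F 1 one_pos
  rw [Metric.mem_ball, ContinuousMap.dist_lt_iff one_pos] at hfF
  have hfF' : ∀ y, |f y - (g y + g y - 1)| < 1 := hfF
  refine ⟨{y | f y < 0}, ?_, fun y hy => ?_, fun μ hμ => ?_⟩
  · refine (isOpen_lt f.continuous continuous_const).mem_nhds ?_
    have h1 := hfF' x
    have h2 : g x = 0 := hg0 rfl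
    rw [h2, abs_lt] at h1
    change f x < 0
    linarith
  · by_contra hyU
    have h1 := hfF' y
    have h2 : g y = 1 := hg1 hyU
    rw [h2, abs_lt] at h1
    change f y < 0 at hy
    linarith
  · have hle : ∀ n : ℕ, μ (frontier {y | f y < 0}) ≤ ENNReal.ofReal (1 / (n + 1)) := fun n => by
      obtain ⟨δ, hδ, hn⟩ := Set.mem_iInter.mp hfO n
      refine (measure_mono fun y hy => ?_).trans (hn μ hμ)
      have : f y = 0 := frontier_lt_subset_eq f.continuous continuous_const hy
      simpa [this] using hδ
    have ht : Tendsto (fun n : ℕ => ENNReal.ofReal (1 / ((n : ℝ) + 1))) atTop (𝓝 0) := by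
      rw [← ENNReal.ofReal_zero]
      exact ENNReal.tendsto_ofReal tendsto_one_div_add_atTop_nhds_zero_nat
    exact le_antisymm (ge_of_tendsto' ht hle) zero_le

end Baire

/-! ### From traces to measures. -/

section Measures

variable {X : Type*} [TopologicalSpace X] [CompactSpace X] [MeasurableSpace X] [BorelSpace X]
  {A : Type*} [CStarAlgebra A] {D : StarSubalgebra ℂ A}

/-- Markov's inequality for the majorant `Z`, whose integral is its trace. -/
lemma measure_le_of_traceFun_le (e : C(X, ℂ) ≃⋆ₐ[ℂ] D) {μ : Measure X} [IsProbabilityMeasure μ]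
    {τ : A →ₗ[ℂ] ℂ} (hμ : ∀ f : C(X, ℂ), τ ((e f : D) : A) = ∫ x, f x ∂μ) {Z : C(X, ℝ)}
    (hZ : 0 ≤ Z) {s : Set X} (hs : ∀ x ∈ s, 1 ≤ Z x) {ε : ℝ} (h : traceFun e τ Z ≤ ε) :
    μ s ≤ ENNReal.ofReal ε := by
  have hint : traceFun e τ Z = ∫ x, Z x ∂μ := by
    rw [traceFun_apply, realEmb_apply, hμ]
    change (∫ x, (Z x : ℂ) ∂μ).re = _
    rw [integral_complex_ofReal, Complex.ofReal_re]
  have hZi : Integrable (fun x => Z x) μ :=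
    Z.continuous.integrable_of_hasCompactSupport (HasCompactSupport.of_compactSpace _)
  calc μ s ≤ μ {x | 1 ≤ ENNReal.ofReal (Z x)} := measure_mono fun x hx => by
        change 1 ≤ ENNReal.ofReal (Z x)
        rw [ENNReal.one_le_ofReal]
        exact hs x hx
    _ ≤ ∫⁻ x, ENNReal.ofReal (Z x) ∂μ := by
        have := mul_meas_ge_le_lintegral (μ := μ) (f := fun x => ENNReal.ofReal (Z x))
          (by fun_prop) 1
        simpa using this
    _ = ENNReal.ofReal (∫ x, Z x ∂μ) :=
        (ofReal_integral_eq_lintegral_ofReal hZi (Filter.Eventually.of_forall fun x => hZ x)).symm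
    _ ≤ ENNReal.ofReal ε := ENNReal.ofReal_le_ofReal (hint ▸ h)

end Measures

end CStarSBP

end

theorem theorem6p6 {A : Type*} [CStarAlgebra A] [PartialOrder A] [StarOrderedRing A]
    (hA : CStarSBP.IsSimpleCStar A)
    {X : Type*} [TopologicalSpace X] [CompactSpace X] [TopologicalSpace.MetrizableSpace X]
    [MeasurableSpace X] [BorelSpace X]
    (hX : ∀ x : X, ¬ IsOpen ({x} : Set X))
    (D : StarSubalgebra ℂ A) (e : C(X, ℂ) ≃⋆ₐ[ℂ] D)
    (hC : CStarSBP.PropertyC D) (hE : CStarSBP.PropertyE D)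
    (hS : CStarSBP.PropertyS A) :
    CStarSBP.SmallBoundaryProperty (CStarSBP.traceMeasures e) := by
  refine CStarSBP.smallBoundaryProperty_of_dense fun F η ε hη hε => ?_
  obtain ⟨f, hf, δ, hδ, Z, hZ0, hZ, hZε⟩ := CStarSBP.exists_small_near_zero
    (Φ := CStarSBP.traceFun e '' CStarSBP.tracialStates A)
    (by rintro _ ⟨τ, hτ, rfl⟩ F hF; exact CStarSBP.traceFun_nonneg e hτ hF)
    (by rintro _ ⟨τ, hτ, rfl⟩; exact CStarSBP.traceFun_one e hτ)
    (fun F ε hε => by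
      obtain ⟨Q, hQ0, hQ1, hQ⟩ := CStarSBP.exists_almost_indicator e hA hC hE hS F hε
      refine ⟨Q, hQ0, hQ1, ?_⟩
      rintro _ ⟨τ, hτ, rfl⟩
      exact hQ τ hτ) F hη hε
  refine ⟨f, hf, δ, hδ, ?_⟩
  rintro μ ⟨hμ, τ, hτ, hμτ⟩
  exact CStarSBP.measure_le_of_traceFun_le e hμτ hZ0 hZ (hZε _ ⟨τ, hτ, rfl⟩)
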